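/- Let $Y$ and $U$ be Hilbert spaces (both real or both complex), let $A:D(A)\subset Y\to Y$ generate a $C_0$-semigroup $\{S(t)\}_{t\ge 0}$ on $Y$, let $B\in\mathcal L(U;Y)$, and let $T>0$. Write $[s]:=\max\{n\in\mathbb N: n\le s\}$ for $s\ge 0$. The system $y'=Ay+Bu$ is called $(\mathrm{DC})_T$-stabilizable if there is $F\in\mathcal L(Y;U)$ such that the closed-loop system $y'(t)=Ay(t)+BF\,y([t/T]T)$, $t>0$, is exponentially stable, i.e. there are constants $M\ge 1$ and $\omega>0$ such that every mild solution $y\in C([0,\infty);Y)$, that is, every such $y$ with $$y(t)=S(t)y(0)+\int_0^t S(t-s)BF\,y([s/T]T)\,ds\qquad (t\ge 0),$$ satisfies $\|y(t)\|_Y\le Me^{-\omega t}\|y(0)\|_Y$ for all $t\ge 0$. Then the following statements are equivalent: (i) The system $y'=Ay+Bu$ is $(\mathrm{DC})_T$-stabilizable. (ii) There are constants $\omega>0$, $C_1\ge 0$ and $C_2>0$ such that for every integer $N\ge 1$ and every $\varphi\in Y$, $$\|S(NT)^*\varphi\|_Y^2\le C_1\sum_{i=1}^{N}\Big\|\int_{(i-1)T}^{iT}B^*S(t)^*\varphi\,dt\Big\|_U^2+C_2e^{-\omega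 NT}\|\varphi\|_Y^2 .$$ (iii) There are an integer $N\ge 1$ and constants $\delta\in(0,1)$ and $C\ge 0$ such that for every $\varphi\in Y$, $$\|S(NT)^*\varphi\|_Y^2\le C\sum_{i=1}^{N}\Big\|\int_{(i-1)T}^{iT}B^*S(t)^*\varphi\,dt\Big\|_U^2+\delta\|\varphi\|_Y^2 .$$ -/

import Mathlib

open Set Filter Topology MeasureTheory

/-- `S`, restricted to the half-line `[0, ∞)`, is a `C₀`-semigroup of bounded linear operators
on `Y`. The values of `S` at negative times are irrelevant. -/
structure IsC0Semigroup {𝕜 Y : Type*} [RCLike 𝕜] [NormedAddCommGroup Y] [InnerProductSpace 𝕜 Y]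
    (S : ℝ → Y →L[𝕜] Y) : Prop where
  map_zero : S 0 = ContinuousLinearMap.id 𝕜 Y
  map_add : ∀ s t : ℝ, 0 ≤ s → 0 ≤ t → S (s + t) = (S s).comp (S t)
  continuousOn : ∀ x : Y, ContinuousOn (fun t : ℝ => S t x) (Ici 0)

/-- The (unbounded) operator `A : D(A) ⊂ Y → Y` is the infinitesimal generator of `S`:
`x ∈ D(A)` and `A x = z` hold exactly when `(S(t) x - x) / t → z` as `t → 0⁺`. -/
def IsGenerator {𝕜 Y : Type*} [RCLike 𝕜] [NormedAddCommGroup Y] [InnerProductSpace 𝕜 Y]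
    (A : Y →ₗ.[𝕜] Y) (S : ℝ → Y →L[𝕜] Y) : Prop :=
  ∀ x z : Y, (∃ hx : x ∈ A.domain, A ⟨x, hx⟩ = z) ↔
    Tendsto (fun t : ℝ => (t : 𝕜)⁻¹ • (S t x - x)) (𝓝[>] 0) (𝓝 z)

/-- The `T`-periodic discrete observation `(H_T f)(t) = f([t/T] T)`. -/
noncomputable def sampleHold {Y : Type*} (T : ℝ) (f : ℝ → Y) (t : ℝ) : Y :=
  f ((⌊t / T⌋₊ : ℝ) * T)

/-- `y` is a (mild) solution on `[0, ∞)` of `y'(t) = A y(t) + f(t)`, where `A` generates `S`: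
`y ∈ C([0, ∞); Y)` and `y(t) = S(t) y(0) + ∫₀ᵗ S(t - s) f(s) ds` for all `t ≥ 0`. -/
def IsMildSolution {𝕜 Y : Type*} [RCLike 𝕜] [NormedAddCommGroup Y] [InnerProductSpace 𝕜 Y]
    [NormedSpace ℝ Y] (S : ℝ → Y →L[𝕜] Y) (f : ℝ → Y) (y : ℝ → Y) : Prop :=
  ContinuousOn y (Ici 0) ∧
    ∀ t : ℝ, 0 ≤ t → y t = S t (y 0) + ∫ s in (0 : ℝ)..t, S (t - s) (f s)

/-- `y` is a solution of the closed-loop system `y'(t) = A y(t) + B F (H_T y)(t)`. -/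
def IsClosedLoopSolution {𝕜 Y U : Type*} [RCLike 𝕜]
    [NormedAddCommGroup Y] [InnerProductSpace 𝕜 Y] [NormedSpace ℝ Y]
    [NormedAddCommGroup U] [InnerProductSpace 𝕜 U]
    (S : ℝ → Y →L[𝕜] Y) (B : U →L[𝕜] Y) (F : Y →L[𝕜] U) (T : ℝ) (y : ℝ → Y) : Prop :=
  IsMildSolution S (fun t => B (F (sampleHold T y t))) y

/-- The system `y' = A y + B u`, where `A` generates `S`, is `(DC)_T`-stabilizable: for some
bounded linear feedback `F` the closed-loop system is exponentially stable. -/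
def IsDCStabilizable {𝕜 Y U : Type*} [RCLike 𝕜]
    [NormedAddCommGroup Y] [InnerProductSpace 𝕜 Y] [NormedSpace ℝ Y]
    [NormedAddCommGroup U] [InnerProductSpace 𝕜 U]
    (S : ℝ → Y →L[𝕜] Y) (B : U →L[𝕜] Y) (T : ℝ) : Prop :=
  ∃ F : Y →L[𝕜] U, ∃ M ω : ℝ, 1 ≤ M ∧ 0 < ω ∧
    ∀ y : ℝ → Y, IsClosedLoopSolution S B F T y →
      ∀ t : ℝ, 0 ≤ t → ‖y t‖ ≤ M * Real.exp (-ω * t) * ‖y 0‖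

/-- The sampled observation `∑_{i=1}^N ‖∫_{(i-1)T}^{iT} B^* S(t)^* φ dt‖²`. -/
noncomputable def sampledObservation {𝕜 Y U : Type*} [RCLike 𝕜]
    [NormedAddCommGroup Y] [InnerProductSpace 𝕜 Y] [CompleteSpace Y]
    [NormedAddCommGroup U] [InnerProductSpace 𝕜 U] [CompleteSpace U] [NormedSpace ℝ U]
    (S : ℝ → Y →L[𝕜] Y) (B : U →L[𝕜] Y) (T : ℝ) (N : ℕ) (φ : Y) : ℝ :=
  ∑ i ∈ Finset.Icc 1 N,
    ‖∫ t in (((i : ℝ) - 1) * T)..((i : ℝ) * T),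
      ContinuousLinearMap.adjoint B (ContinuousLinearMap.adjoint (S t) φ)‖ ^ 2

/-! Sampling at the times `k * T` turns the problem into the discrete system `y (k + 1) = P (y k) +
Q (u k)` with `P = S T` and `Q = ∫₀ᵀ S(s) B ds`. Between samples a closed-loop solution is
controlled by its last sample, so stabilizability means that some `P + Q F` has exponentially
decaying powers (`isDCStabilizable_iff`). The observation integrals become `Q^* P^*^i φ`
(`sampledObservation_eq`), and both inequalities become statements about `P^*` and `Q^*`.

(i) → (ii): write `P^* = G - F^* Q^*` with `G = (P + Q F)^*`, expand `P^*^N` by variation of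
constants and apply Cauchy–Schwarz; the decay of `G ^ k` keeps the constant independent of `N`. (ii)
→ (iii): take `N` large.

(iii) → (i): a Tikhonov-regularized Gramian gives an `N`-step control law, linear in the initial
state, that contracts the state. Repeating it periodically gives a square summable trajectory from
every state. The trajectories of minimal norm are linear in the initial state and, since tails of
minimal trajectories are minimal, come from a stationary feedback. A discrete Datko argument turns
square summability into exponential decay. No Riccati equation is needed. -/

open ContinuousLinearMap (adjoint)

/-! ### Exponential decay of powers of a bounded operator. -/

section PowerBounds

variable {𝕜 Y : Type*} [RCLike 𝕜] [NormedAddCommGroup Y] [NormedSpace 𝕜 Y]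

/-- A bounded operator with a strictly contractive positive power has exponentially decaying
powers. -/
theorem exists_norm_pow_le_of_norm_pow_lt_one (G : Y →L[𝕜] Y) {n : ℕ} (hn : 0 < n) {q : ℝ}
    (hq0 : 0 < q) (hq1 : q < 1) (hq : ‖G ^ n‖ ≤ q) :
    ∃ M ρ : ℝ, 0 ≤ M ∧ 0 < ρ ∧ ρ < 1 ∧ ∀ k, ‖G ^ k‖ ≤ M * ρ ^ k := by
  obtain ⟨C, hC⟩ : ∃ C : ℝ, ∀ i ∈ Finset.range n, ‖G ^ i‖ ≤ C :=
    ⟨∑ i ∈ Finset.range n, ‖G ^ i‖, fun i hi =>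
      Finset.single_le_sum (f := fun i => ‖G ^ i‖) (fun _ _ => norm_nonneg _) hi⟩
  have hC0 : 0 ≤ C := (norm_nonneg _).trans (hC 0 (by simpa using hn))
  have hn' : (0 : ℝ) < n := by exact_mod_cast hn
  -- With `ρ ^ n = q`, rounding `k / n` down costs at most one factor `q`, hence the constant `C /
  -- q`.
  set ρ : ℝ := q ^ (1 / (n : ℝ)) with hρ
  have hρ0 : 0 < ρ := Real.rpow_pos_of_pos hq0 _
  have hρ1 : ρ < 1 := Real.rpow_lt_one hq0.le hq1 (by positivity)
  have hρn : ρ ^ n = q := by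
    rw [hρ, ← Real.rpow_natCast, ← Real.rpow_mul hq0.le]
    field_simp
    simp
  refine ⟨C / q, ρ, by positivity, hρ0, hρ1, fun k => ?_⟩
  have h1 : ‖G ^ k‖ ≤ C * q ^ (k / n) := by
    conv_lhs => rw [← Nat.mod_add_div k n, pow_add, pow_mul]
    refine (norm_mul_le _ _).trans ?_
    refine mul_le_mul (hC _ (by simpa using Nat.mod_lt k hn)) ?_ (norm_nonneg _) hC0
    rcases Nat.eq_zero_or_pos (k / n) with h | h
    · rw [h]
      simpa using! (ContinuousLinearMap.norm_id_le : ‖ContinuousLinearMap.id 𝕜 Y‖ ≤ 1)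
    · exact (norm_pow_le' _ h).trans (pow_le_pow_left₀ (norm_nonneg _) hq _)
  refine h1.trans ?_
  rw [div_mul_eq_mul_div, mul_div_assoc]
  refine mul_le_mul_of_nonneg_left ?_ hC0
  rw [le_div_iff₀ hq0, ← pow_succ, ← hρn, ← pow_mul]
  refine pow_le_pow_of_le_one hρ0.le hρ1.le ?_
  have := Nat.mod_add_div k n
  have := Nat.mod_lt k hn
  rw [Nat.mul_succ]
  omega

/-- Discrete Datko theorem: an operator all of whose orbits are square summable, with a uniform
bound, has exponentially decaying powers. -/
theorem exists_norm_pow_le_of_sum_sq_le (G : Y →L[𝕜] Y) {c : ℝ}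
    (h : ∀ (y : Y) (n : ℕ), ∑ k ∈ Finset.range n, ‖(G ^ k) y‖ ^ 2 ≤ c ^ 2 * ‖y‖ ^ 2) :
    ∃ M ρ : ℝ, 0 ≤ M ∧ 0 < ρ ∧ ρ < 1 ∧ ∀ k, ‖G ^ k‖ ≤ M * ρ ^ k := by
  have hb : ∀ (y : Y) (k : ℕ), ‖(G ^ k) y‖ ^ 2 ≤ c ^ 2 * ‖y‖ ^ 2 := fun y k =>
    (Finset.single_le_sum (f := fun k => ‖(G ^ k) y‖ ^ 2) (fun _ _ => by positivity)
      (Finset.self_mem_range_succ k)).trans (h y (k + 1))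
  -- Uniform power boundedness bounds the `n`-th term by `c ^ 2` times each earlier one; summing
  -- these gives `‖G ^ n‖ ^ 2 ≤ c ^ 4 / n`, so `n > 4 * c ^ 4` yields norm at most `1 / 2`.
  have hd : ∀ (y : Y) (n : ℕ), (n : ℝ) * ‖(G ^ n) y‖ ^ 2 ≤ c ^ 4 * ‖y‖ ^ 2 := by
    intro y n
    calc (n : ℝ) * ‖(G ^ n) y‖ ^ 2 = ∑ k ∈ Finset.range n, ‖(G ^ n) y‖ ^ 2 := by simp
      _ ≤ ∑ k ∈ Finset.range n, c ^ 2 * ‖(G ^ k) y‖ ^ 2 := by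
          refine Finset.sum_le_sum fun k hk => ?_
          have hk' : n = n - k + k := by have := Finset.mem_range.1 hk; omega
          conv_lhs => rw [hk', pow_add]
          exact hb _ _
      _ ≤ c ^ 2 * (c ^ 2 * ‖y‖ ^ 2) := by
          rw [← Finset.mul_sum]
          exact mul_le_mul_of_nonneg_left (h y n) (by positivity)
      _ = c ^ 4 * ‖y‖ ^ 2 := by ring
  obtain ⟨n, hn⟩ := exists_nat_gt (4 * c ^ 4)
  have hn0 : (0 : ℝ) < n := lt_of_le_of_lt (by positivity) hn
  refine exists_norm_pow_le_of_norm_pow_lt_one G (n := n) (by exact_mod_cast hn0)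
    (q := 1 / 2) (by norm_num) (by norm_num)
    (ContinuousLinearMap.opNorm_le_bound _ (by norm_num) fun y => ?_)
  refine abs_le_of_sq_le_sq' ?_ (by positivity) |>.2
  have h1 := hd y n
  have h2 : c ^ 4 * ‖y‖ ^ 2 ≤ (n / 4) * ‖y‖ ^ 2 :=
    mul_le_mul_of_nonneg_right (by linarith) (by positivity)
  have h3 : (n : ℝ) * ‖(G ^ n) y‖ ^ 2 ≤ n * (1 / 2 * ‖y‖) ^ 2 := by nlinarith
  exact le_of_mul_le_mul_left h3 hn0

end PowerBounds

/-! ### Square summable trajectories of minimal norm. -/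

section MinimalTrajectories

variable {𝕜 X Y : Type*} [RCLike 𝕜] [NormedAddCommGroup X] [InnerProductSpace 𝕜 X]
  [NormedAddCommGroup Y] [InnerProductSpace 𝕜 Y]

/-- The square summable sequences `x` in `X` with `a (x (n + 1)) = b (x n)`. -/
def trajectorySpace (a b : X →L[𝕜] Y) : Submodule 𝕜 (lp (fun _ : ℕ => X) 2) where
  carrier := {x | ∀ n, a (x (n + 1)) = b (x n)}
  add_mem' := by
    intro x y hx hy n
    simp only [mem_ofPred_eq] at hx hy
    simp [hx n, hy n]
  zero_mem' := by intro n; simp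
  smul_mem' := by
    intro c x hx n
    simp only [mem_ofPred_eq] at hx
    simp [hx n]

theorem mem_trajectorySpace {a b : X →L[𝕜] Y} {x : lp (fun _ : ℕ => X) 2} :
    x ∈ trajectorySpace a b ↔ ∀ n, a (x (n + 1)) = b (x n) := Iff.rfl

theorem isClosed_trajectorySpace (a b : X →L[𝕜] Y) :
    IsClosed (trajectorySpace a b : Set (lp (fun _ : ℕ => X) 2)) := by
  have : (trajectorySpace a b : Set (lp (fun _ : ℕ => X) 2)) =
      ⋂ n, {x | a (lp.evalCLM 𝕜 (fun _ : ℕ => X) 2 (n + 1) x) =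
        b (lp.evalCLM 𝕜 (fun _ : ℕ => X) 2 n x)} := by
    ext x
    simp only [SetLike.mem_coe, mem_trajectorySpace, mem_iInter, mem_ofPred_eq]
    rfl
  rw [this]
  exact isClosed_iInter fun n => isClosed_eq (by fun_prop) (by fun_prop)

/-- The sequence shifted one step to the left. -/
def lpTail (x : lp (fun _ : ℕ => X) 2) : lp (fun _ : ℕ => X) 2 :=
  ⟨fun n => x (n + 1), memℓp_gen (by
    have := (lp.memℓp x).summable (by simp)
    exact (summable_nat_add_iff 1).2 this)⟩

/-- The sequence shifted one step to the right, with first term `0`. -/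
def lpConsZero (x : lp (fun _ : ℕ => X) 2) : lp (fun _ : ℕ => X) 2 :=
  ⟨fun n => Nat.casesOn n 0 x, memℓp_gen (by
    have := (lp.memℓp x).summable (by simp)
    exact (summable_nat_add_iff 1).1 this)⟩

@[simp] theorem lpTail_apply (x : lp (fun _ : ℕ => X) 2) (n : ℕ) : lpTail x n = x (n + 1) := rfl

@[simp] theorem lpConsZero_zero (x : lp (fun _ : ℕ => X) 2) : lpConsZero x 0 = 0 := rfl

@[simp] theorem lpConsZero_succ (x : lp (fun _ : ℕ => X) 2) (n : ℕ) :
    lpConsZero x (n + 1) = x n := rfl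

/-- The two shifts are adjoint to each other; this carries orthogonality from a minimal trajectory
to its tail. -/
theorem inner_lpTail (x z : lp (fun _ : ℕ => X) 2) :
    inner 𝕜 (lpTail x) z = inner 𝕜 x (lpConsZero z) := by
  have h1 := lp.inner_eq_tsum (𝕜 := 𝕜) (lpTail x) z
  have h2 := lp.inner_eq_tsum (𝕜 := 𝕜) x (lpConsZero z)
  have h3 := (lp.summable_inner (𝕜 := 𝕜) x (lpConsZero z)).tsum_eq_zero_add
  rw [h1, h2, h3, lpConsZero_zero, inner_zero_right, zero_add]
  rfl

/-- A bounded surjection of Hilbert spaces has a bounded right inverse, which takes values in the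
orthogonal complement of the kernel. -/
theorem exists_rightInverse_mem_orthogonal_ker {H : Type*} [NormedAddCommGroup H]
    [InnerProductSpace 𝕜 H] [CompleteSpace H] [CompleteSpace Y] (E : H →L[𝕜] Y)
    (hE : Function.Surjective E) :
    ∃ ℓ : Y →L[𝕜] H, (∀ y, E (ℓ y) = y) ∧
      ∀ x : H, (∀ z : H, E z = 0 → inner 𝕜 z x = 0) ↔ ℓ (E x) = x := by
  let K : Submodule 𝕜 H := LinearMap.ker (E : H →ₗ[𝕜] Y)
  have hK : ∀ x, x ∈ K ↔ E x = 0 := fun x => LinearMap.mem_ker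
  have : CompleteSpace K := E.isClosed_ker.completeSpace_coe
  -- Restricted to the orthogonal complement of its kernel, `E` is bijective, and its inverse is
  -- bounded by the open mapping theorem.
  let E' : Kᗮ →L[𝕜] Y := E.comp Kᗮ.subtypeL
  have hker : E'.ker = ⊥ := by
    rw [Submodule.eq_bot_iff]
    intro x hx
    have h1 : (x : H) ∈ K := hx
    have h2 := Submodule.inner_right_of_mem_orthogonal h1 x.2
    exact Subtype.ext (inner_self_eq_zero.1 h2)
  have hrange : E'.range = ⊤ := by
    rw [LinearMap.range_eq_top]
    intro y
    obtain ⟨x, hxy⟩ := hE y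
    obtain ⟨u, hu, v, hv, huv⟩ := K.exists_add_mem_mem_orthogonal x
    refine ⟨⟨v, hv⟩, ?_⟩
    rw [huv, map_add, (hK u).1 hu, zero_add] at hxy
    exact hxy
  let e := ContinuousLinearEquiv.ofBijective E' hker hrange
  let ℓ : Y →L[𝕜] H := Kᗮ.subtypeL.comp (e.symm : Y →L[𝕜] Kᗮ)
  have hEℓ : ∀ y, E (ℓ y) = y := fun y =>
    ContinuousLinearEquiv.ofBijective_apply_symm_apply E' hker hrange y
  have hℓ : ∀ y, ℓ y ∈ Kᗮ := fun y => (e.symm y).2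
  refine ⟨ℓ, hEℓ, fun x => ⟨fun hx => ?_, fun hx z hz => ?_⟩⟩
  · have h5 : ℓ (E x) - x ∈ K := by
      rw [hK, map_sub, hEℓ, sub_self]
    have h6 : ℓ (E x) - x ∈ Kᗮ := Submodule.sub_mem _ (hℓ _)
      ((Submodule.mem_orthogonal _ _).2 fun z hz => hx z ((hK z).1 hz))
    exact sub_eq_zero.1 (inner_self_eq_zero.1 (Submodule.inner_right_of_mem_orthogonal h5 h6))
  · rw [← hx]
    exact Submodule.inner_right_of_mem_orthogonal ((hK z).2 hz) (hℓ _)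

/-- If every `y` is `a (x 0)` for some square summable trajectory `a (x (n + 1)) = b (x n)`, then
the trajectories of minimal norm are generated by a bounded right inverse `R` of `a`: they are
`x n = R ((b R) ^ n y)`. -/
theorem exists_rightInverse_sum_sq_le [CompleteSpace X] [CompleteSpace Y] (a b : X →L[𝕜] Y)
    (h : ∀ y, ∃ x ∈ trajectorySpace a b, a (x 0) = y) :
    ∃ R : Y →L[𝕜] X, (∀ y, a (R y) = y) ∧ ∃ c : ℝ, ∀ (y : Y) (n : ℕ),
      ∑ k ∈ Finset.range n, ‖R (((b.comp R) ^ k) y)‖ ^ 2 ≤ c ^ 2 * ‖y‖ ^ 2 := by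
  have : CompleteSpace (trajectorySpace a b) :=
    (isClosed_trajectorySpace a b).completeSpace_coe
  let ev : trajectorySpace a b →L[𝕜] X :=
    (lp.evalCLM 𝕜 (fun _ : ℕ => X) 2 0).comp (trajectorySpace a b).subtypeL
  obtain ⟨ℓ, hℓ, horth⟩ := exists_rightInverse_mem_orthogonal_ker (a.comp ev) (fun y => by
    obtain ⟨x, hx, hxy⟩ := h y
    exact ⟨⟨x, hx⟩, hxy⟩)
  let R : Y →L[𝕜] X := ev.comp ℓ
  -- Bellman's principle. If `z` is a trajectory with `a (z 0) = 0`, prepending `0` gives another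
  -- trajectory in the kernel of `a.comp ev`. It is orthogonal to `ℓ y`, so `z` is orthogonal to the
  -- tail of `ℓ y`, which is therefore minimal for its own starting state `b (R y)`.
  have htail : ∀ y, lpTail (ℓ y : lp (fun _ : ℕ => X) 2) =
      (ℓ (b (R y)) : lp (fun _ : ℕ => X) 2) := by
    intro y
    have hmem : lpTail (ℓ y : lp (fun _ : ℕ => X) 2) ∈ trajectorySpace a b := fun n =>
      (ℓ y).2 (n + 1)
    have h7 := (horth ⟨_, hmem⟩).1 (by
      intro z hz
      have hz0 : a ((z : lp (fun _ : ℕ => X) 2) 0) = 0 := hz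
      have hc : lpConsZero (z : lp (fun _ : ℕ => X) 2) ∈ trajectorySpace a b := by
        intro n
        cases n with
        | zero => simp [hz0]
        | succ n => simpa using z.2 n
      have h8 := (horth (ℓ y)).2 (by rw [hℓ]) ⟨_, hc⟩ (map_zero a)
      rw [← inner_conj_symm, map_eq_zero] at h8 ⊢
      rw [Submodule.coe_inner] at h8 ⊢
      rw [inner_lpTail]
      exact h8)
    have h9 : (a.comp ev) ⟨_, hmem⟩ = b (R y) := (ℓ y).2 0
    rw [h9] at h7
    rw [h7]
  have htraj : ∀ (k : ℕ) (y : Y), (ℓ y : lp (fun _ : ℕ => X) 2) k =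
      R (((b.comp R) ^ k) y) := by
    intro k
    induction k with
    | zero => intro y; rfl
    | succ k ih =>
      intro y
      rw [← lpTail_apply, htail, ih, pow_succ]
      rfl
  refine ⟨R, hℓ, ‖ℓ‖, fun y n => ?_⟩
  have h9 := lp.sum_rpow_le_norm_rpow (p := 2) (by simp) (ℓ y : lp (fun _ : ℕ => X) 2)
    (Finset.range n)
  simp only [htraj] at h9
  simp only [ENNReal.toReal_ofNat, Real.rpow_ofNat] at h9
  refine h9.trans ?_
  rw [← mul_pow]
  exact pow_le_pow_left₀ (norm_nonneg _) (ℓ.le_opNorm y) 2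

end MinimalTrajectories

/-! ### Stabilization and weak observability in discrete time. -/

section DiscreteSystems

variable {𝕜 Y U : Type*} [RCLike 𝕜] [NormedAddCommGroup Y] [InnerProductSpace 𝕜 Y]
  [CompleteSpace Y] [NormedAddCommGroup U] [InnerProductSpace 𝕜 U]

theorem summable_pow_div {q : ℝ} (hq0 : 0 ≤ q) (hq1 : q < 1) {N : ℕ} (hN : 0 < N) :
    Summable fun k : ℕ => q ^ (k / N) := by
  have : NeZero N := ⟨hN.ne'⟩
  rw [← (Nat.divModEquiv N).symm.summable_iff]
  have h : (fun k : ℕ => q ^ (k / N)) ∘ (Nat.divModEquiv N).symm =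
      fun p : ℕ × Fin N => q ^ p.1 := by
    funext p
    have : (Nat.divModEquiv N).symm p / N = p.1 :=
      congrArg Prod.fst ((Nat.divModEquiv N).apply_symm_apply p)
    simp only [Function.comp_apply, this]
  rw [h, summable_prod_of_nonneg (fun p => pow_nonneg hq0 _)]
  refine ⟨fun x => Summable.of_finite, ?_⟩
  simp only [tsum_fintype, Finset.sum_const, nsmul_eq_mul]
  exact (summable_geometric_of_lt_one hq0 hq1).mul_left _

/-- If `N` steps of time-dependent feedback `K 0, …, K (N - 1)` contract the state of
`y (k + 1) = P (y k) + Q (u k)`, then some stationary feedback stabilizes this system. -/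
theorem exists_stabilizing_feedback_of_contraction [CompleteSpace U] (P : Y →L[𝕜] Y)
    (Q : U →L[𝕜] Y) (K : ℕ → Y →L[𝕜] U)
    (Φ : ℕ → Y →L[𝕜] Y) (hΦ0 : Φ 0 = 1) (hΦ : ∀ i, Φ (i + 1) = P * Φ i + Q.comp (K i))
    {N : ℕ} (hN : 0 < N) (hc : ‖Φ N‖ < 1) :
    ∃ (F : Y →L[𝕜] U) (M ρ : ℝ), 0 ≤ M ∧ 0 < ρ ∧ ρ < 1 ∧
      ∀ k, ‖(P + Q.comp F) ^ k‖ ≤ M * ρ ^ k := by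
  -- Trajectories live in the Hilbert space of pairs (state, control): `a` reads the state, `w` the
  -- control and `b` gives the next state.
  let e := WithLp.prodContinuousLinearEquiv 2 𝕜 Y U
  let a : WithLp 2 (Y × U) →L[𝕜] Y := (ContinuousLinearMap.fst 𝕜 Y U).comp e.toContinuousLinearMap
  let w : WithLp 2 (Y × U) →L[𝕜] U := (ContinuousLinearMap.snd 𝕜 Y U).comp e.toContinuousLinearMap
  let b : WithLp 2 (Y × U) →L[𝕜] Y := P.comp a + Q.comp w
  -- The `N`-step law is restarted every `N` steps, from the state `Φ N ^ (k / N)` applied to `y`.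
  let s : Y → ℕ → WithLp 2 (Y × U) := fun y k =>
    e.symm (Φ (k % N) ((Φ N ^ (k / N)) y), K (k % N) ((Φ N ^ (k / N)) y))
  have hs : ∀ y, Memℓp (s y) 2 := by
    intro y
    let A : ℕ → Y →L[𝕜] WithLp 2 (Y × U) := fun i =>
      e.symm.toContinuousLinearMap.comp ((Φ i).prod (K i))
    obtain ⟨c, hc0⟩ : ∃ c : ℝ, ∀ i ∈ Finset.range N, ‖A i‖ ≤ c :=
      ⟨∑ i ∈ Finset.range N, ‖A i‖, fun i hi =>
        Finset.single_le_sum (f := fun i => ‖A i‖) (fun _ _ => norm_nonneg _) hi⟩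
    have hq : ∀ m : ℕ, ‖(Φ N ^ m) y‖ ≤ ‖Φ N‖ ^ m * ‖y‖ := by
      intro m
      induction m with
      | zero => simp
      | succ m ih =>
        rw [pow_succ', pow_succ', mul_assoc]
        exact (Φ N).le_opNorm_of_le ih
    refine memℓp_gen ?_
    simp only [ENNReal.toReal_ofNat, Real.rpow_ofNat]
    refine Summable.of_nonneg_of_le (fun k => by positivity) (fun k => ?_)
      ((summable_pow_div (sq_nonneg ‖Φ N‖)
        (pow_lt_one₀ (norm_nonneg _) hc two_ne_zero) hN).mul_left (c ^ 2 * ‖y‖ ^ 2))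
    have h1 : ‖s y k‖ ≤ c * (‖Φ N‖ ^ (k / N) * ‖y‖) :=
      ((A (k % N)).le_opNorm _).trans (mul_le_mul
        (hc0 _ (Finset.mem_range.2 (Nat.mod_lt k hN))) (hq _) (norm_nonneg _)
        ((norm_nonneg _).trans (hc0 _ (Finset.mem_range.2 hN))))
    refine (pow_le_pow_left₀ (norm_nonneg _) h1 2).trans (le_of_eq ?_)
    rw [← pow_mul, mul_comm 2, pow_mul]
    ring
  obtain ⟨R, haR, c, hR⟩ := exists_rightInverse_sum_sq_le a b (fun y => by
    refine ⟨⟨s y, hs y⟩, fun k => ?_, ?_⟩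
    · change Φ ((k + 1) % N) ((Φ N ^ ((k + 1) / N)) y) = P (Φ (k % N) ((Φ N ^ (k / N)) y)) +
        Q (K (k % N) ((Φ N ^ (k / N)) y))
      have h2 : ∀ z, P (Φ (k % N) z) + Q (K (k % N) z) = Φ (k % N + 1) z := fun z => by
        rw [hΦ]; rfl
      rw [h2]
      have h3 := Nat.mod_lt k hN
      rcases Nat.lt_or_ge (k % N + 1) N with h | h
      · have h4 : (k + 1) / N = k / N ∧ (k + 1) % N = k % N + 1 :=
          (Nat.div_mod_unique hN).2 ⟨by have := Nat.mod_add_div k N; omega, h⟩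
        rw [h4.1, h4.2]
      · have h4 : (k + 1) / N = k / N + 1 ∧ (k + 1) % N = 0 :=
          (Nat.div_mod_unique hN).2 ⟨by
            have := Nat.mod_add_div k N
            rw [mul_add]
            omega, hN⟩
        have h5 : k % N + 1 = N := by omega
        rw [h4.1, h4.2, hΦ0, h5, pow_succ']
        rfl
    · change Φ (0 % N) ((Φ N ^ (0 / N)) y) = y
      simp [hΦ0])
  -- Since `R` is a right inverse of `a`, the minimal control is the stationary feedback `w.comp R`.
  have hG : b.comp R = P + Q.comp (w.comp R) := by
    ext y
    change P (a (R y)) + Q (w (R y)) = P y + Q (w (R y))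
    rw [haR]
  refine ⟨w.comp R, exists_norm_pow_le_of_sum_sq_le _ (c := ‖a‖ * c) fun y n => ?_⟩
  rw [← hG]
  calc ∑ k ∈ Finset.range n, ‖((b.comp R) ^ k) y‖ ^ 2
      ≤ ∑ k ∈ Finset.range n, ‖a‖ ^ 2 * ‖R (((b.comp R) ^ k) y)‖ ^ 2 := by
        refine Finset.sum_le_sum fun k _ => ?_
        conv_lhs => rw [← haR (((b.comp R) ^ k) y)]
        rw [← mul_pow]
        exact pow_le_pow_left₀ (norm_nonneg _) (a.le_opNorm _) 2
    _ ≤ ‖a‖ ^ 2 * (c ^ 2 * ‖y‖ ^ 2) := by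
        rw [← Finset.mul_sum]
        exact mul_le_mul_of_nonneg_left (hR y n) (by positivity)
    _ = (‖a‖ * c) ^ 2 * ‖y‖ ^ 2 := by ring

/-- The controllability Gramian `∑_{j < N} P ^ j Q Q^* P^* ^ j`. -/
noncomputable def gramian [CompleteSpace U] (P : Y →L[𝕜] Y) (Q : U →L[𝕜] Y) (N : ℕ) :
    Y →L[𝕜] Y :=
  ∑ j ∈ Finset.range N, P ^ j * (Q.comp (adjoint Q)) * adjoint P ^ j

theorem star_gramian [CompleteSpace U] (P : Y →L[𝕜] Y) (Q : U →L[𝕜] Y) (N : ℕ) :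
    star (gramian P Q N) = gramian P Q N := by
  have h : star (Q.comp (adjoint Q)) = Q.comp (adjoint Q) := by
    rw [ContinuousLinearMap.star_eq_adjoint, ContinuousLinearMap.adjoint_comp,
      ContinuousLinearMap.adjoint_adjoint]
  simp only [gramian, star_sum, star_mul, star_pow, h, ← ContinuousLinearMap.star_eq_adjoint P,
    star_star, mul_assoc]

theorem inner_gramian_self [CompleteSpace U] (P : Y →L[𝕜] Y) (Q : U →L[𝕜] Y) (N : ℕ) (φ : Y) :
    inner 𝕜 (gramian P Q N φ) φ =
      ((∑ i ∈ Finset.range N, ‖adjoint Q ((adjoint P ^ i) φ)‖ ^ 2 : ℝ) : 𝕜) := by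
  have h : ∀ i : ℕ, inner 𝕜 ((P ^ i * (Q.comp (adjoint Q)) * adjoint P ^ i) φ) φ =
      ((‖adjoint Q ((adjoint P ^ i) φ)‖ ^ 2 : ℝ) : 𝕜) := by
    intro i
    have h1 : adjoint (P ^ i) = adjoint P ^ i := by
      simp only [← ContinuousLinearMap.star_eq_adjoint, star_pow]
    change inner 𝕜 ((P ^ i) (Q (adjoint Q ((adjoint P ^ i) φ)))) φ = _
    rw [← ContinuousLinearMap.adjoint_inner_right, ← ContinuousLinearMap.adjoint_inner_right, h1,
      inner_self_eq_norm_sq_to_K]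
    push_cast
    rfl
  rw [gramian, sum_apply, sum_inner, Finset.sum_congr rfl fun i _ => h i]
  push_cast
  rfl

/-- A weak observability inequality for the adjoint system yields a stabilizing feedback. -/
theorem exists_stabilizing_feedback_of_observability [CompleteSpace U] (P : Y →L[𝕜] Y)
    (Q : U →L[𝕜] Y) {N : ℕ} (hN : 0 < N) {δ C : ℝ} (hδ0 : 0 < δ) (hδ1 : δ < 1) (hC : 0 ≤ C)
    (h : ∀ φ : Y, ‖(adjoint P ^ N) φ‖ ^ 2 ≤
      C * ∑ i ∈ Finset.range N, ‖adjoint Q ((adjoint P ^ i) φ)‖ ^ 2 + δ * ‖φ‖ ^ 2) :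
    ∃ (F : Y →L[𝕜] U) (M ρ : ℝ), 0 ≤ M ∧ 0 < ρ ∧ ρ < 1 ∧
      ∀ k, ‖(P + Q.comp F) ^ k‖ ≤ M * ρ ^ k := by
  -- Small enough that `C * ε + δ < 1`, which will be the squared contraction factor.
  set ε : ℝ := (1 - δ) / (2 * (C + 1)) with hε
  have hε0 : 0 < ε := div_pos (by linarith) (by linarith)
  have hCε : C * ε + δ < 1 := by
    have : C * ε ≤ (1 - δ) / 2 := by
      rw [hε, mul_div_assoc', div_le_div_iff₀ (by linarith) (by norm_num)]
      nlinarith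
    linarith
  set D : Y →L[𝕜] Y := gramian P Q N + (ε : 𝕜) • 1 with hD
  have hDstar : star D = D := by
    rw [hD, star_add, star_gramian, star_smul, star_one, RCLike.star_def, RCLike.conj_ofReal]
  have hDinner : ∀ φ, RCLike.re (inner 𝕜 (D φ) φ) =
      ∑ i ∈ Finset.range N, ‖adjoint Q ((adjoint P ^ i) φ)‖ ^ 2 + ε * ‖φ‖ ^ 2 := by
    intro φ
    have h1 : D φ = gramian P Q N φ + (ε : 𝕜) • φ := rfl
    rw [h1, inner_add_left, inner_gramian_self, inner_smul_left, RCLike.conj_ofReal, map_add,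
      RCLike.ofReal_re, RCLike.re_ofReal_mul, inner_self_eq_norm_sq]
  have hsum0 : ∀ φ, 0 ≤ ∑ i ∈ Finset.range N, ‖adjoint Q ((adjoint P ^ i) φ)‖ ^ 2 := fun φ =>
    Finset.sum_nonneg fun _ _ => by positivity
  obtain ⟨u, hu⟩ : IsUnit D := by
    refine ContinuousLinearMap.isUnit_of_forall_le_norm_inner_map D (c := ⟨ε, hε0.le⟩) hε0
      fun φ => ?_
    have h2 := hDinner φ
    have h3 := RCLike.re_le_norm (inner 𝕜 (D φ) φ)
    have h4 := hsum0 φ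
    change ‖φ‖ ^ 2 * ε ≤ _
    linarith
  set R : Y →L[𝕜] Y := ((u⁻¹ : (Y →L[𝕜] Y)ˣ) : Y →L[𝕜] Y) with hR
  have hDR : D * R = 1 := by rw [← hu, hR, Units.mul_inv]
  have hRstar : star R = R := by
    have h5 : star R * D = 1 := by
      rw [← star_one, ← hDR, star_mul, hDstar]
    calc star R = star R * (D * R) := by rw [hDR, mul_one]
      _ = R := by rw [← mul_assoc, h5, one_mul]
  -- The control minimizing control energy plus `ε⁻¹` times the squared norm of the final state;
  -- with `D = gramian P Q N + ε` and `R = D⁻¹` the final state is `ε R P ^ N y`.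
  let K : ℕ → Y →L[𝕜] U := fun i =>
    -((adjoint Q).comp (adjoint P ^ (N - 1 - i) * R * P ^ N))
  let Φ : ℕ → Y →L[𝕜] Y := fun n =>
    Nat.rec 1 (fun i T => P * T + Q.comp (K i)) n
  have hΦ : ∀ i, Φ (i + 1) = P * Φ i + Q.comp (K i) := fun i => rfl
  have hΦsum : ∀ n, Φ n = P ^ n + ∑ i ∈ Finset.range n, P ^ (n - 1 - i) * Q.comp (K i) := by
    intro n
    induction n with
    | zero => simp [Φ]
    | succ n ih =>
      rw [hΦ, ih, Finset.sum_range_succ, mul_add, Finset.mul_sum, pow_succ', add_assoc]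
      congr 1
      congr 1
      · refine Finset.sum_congr rfl fun i hi => ?_
        have := Finset.mem_range.1 hi
        rw [← mul_assoc, ← pow_succ']
        congr 2
        omega
      · simp
  have hΦN : Φ N = (ε : 𝕜) • (R * P ^ N) := by
    have h6 : ∑ i ∈ Finset.range N, P ^ (N - 1 - i) * Q.comp (K i) =
        -(gramian P Q N * R * P ^ N) := by
      rw [gramian, ← Finset.sum_range_reflect, Finset.sum_mul, Finset.sum_mul,
        ← Finset.sum_neg_distrib]
      refine Finset.sum_congr rfl fun i hi => ?_
      have : N - 1 - (N - 1 - i) = i := by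
        have := Finset.mem_range.1 hi
        omega
      ext y
      simp [K, this]
    have h7 : gramian P Q N = D - (ε : 𝕜) • 1 := by rw [hD, add_sub_cancel_right]
    rw [hΦsum, h6, h7, sub_mul, hDR, sub_mul, one_mul, smul_mul_assoc, one_mul, smul_mul_assoc]
    abel
  refine exists_stabilizing_feedback_of_contraction P Q K Φ rfl hΦ hN ?_
  have h8 : star (Φ N) = (ε : 𝕜) • (adjoint P ^ N * R) := by
    rw [hΦN, star_smul, star_mul, hRstar, star_pow, RCLike.star_def, RCLike.conj_ofReal,
      ContinuousLinearMap.star_eq_adjoint]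
  -- For `ψ = ε R φ`, pairing `D ψ = ε φ` with `ψ` bounds `‖ψ‖` by `‖φ‖` and the observation of `ψ`
  -- by `ε * ‖φ‖ ^ 2`. As `star (Φ N) φ = P^*^N ψ`, the hypothesis applied to `ψ` gives the claim.
  have h9 : ∀ φ, ‖(star (Φ N)) φ‖ ^ 2 ≤ (C * ε + δ) * ‖φ‖ ^ 2 := by
    intro φ
    set ψ : Y := (ε : 𝕜) • R φ with hψ
    have hDψ : D ψ = (ε : 𝕜) • φ := by
      rw [hψ, map_smul]
      congr 1
      exact congrArg (fun L : Y →L[𝕜] Y => L φ) hDR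
    have h10 := hDinner ψ
    have h11 : RCLike.re (inner 𝕜 (D ψ) ψ) ≤ ε * (‖φ‖ * ‖ψ‖) := by
      rw [hDψ, inner_smul_left, RCLike.conj_ofReal, RCLike.re_ofReal_mul]
      exact mul_le_mul_of_nonneg_left (re_inner_le_norm _ _) hε0.le
    have h12 := hsum0 ψ
    have h13 : ‖ψ‖ ≤ ‖φ‖ := by
      by_contra! hlt
      have : ε * (‖φ‖ * ‖ψ‖) < ε * ‖ψ‖ ^ 2 := by
        refine mul_lt_mul_of_pos_left ?_ hε0
        nlinarith [norm_nonneg φ]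
      linarith
    have h14 : ∑ i ∈ Finset.range N, ‖adjoint Q ((adjoint P ^ i) ψ)‖ ^ 2 ≤ ε * ‖φ‖ ^ 2 := by
      have : ε * (‖φ‖ * ‖ψ‖) ≤ ε * ‖φ‖ ^ 2 := by
        refine mul_le_mul_of_nonneg_left ?_ hε0.le
        nlinarith [norm_nonneg φ]
      have := mul_nonneg hε0.le (sq_nonneg ‖ψ‖)
      linarith
    have h15 : star (Φ N) φ = (adjoint P ^ N) ψ := by
      rw [h8, hψ, map_smul]
      rfl
    rw [h15]
    have h16 : ‖ψ‖ ^ 2 ≤ ‖φ‖ ^ 2 := pow_le_pow_left₀ (norm_nonneg _) h13 2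
    calc ‖(adjoint P ^ N) ψ‖ ^ 2 ≤ C * (ε * ‖φ‖ ^ 2) + δ * ‖φ‖ ^ 2 :=
          (h ψ).trans (add_le_add (mul_le_mul_of_nonneg_left h14 hC)
            (mul_le_mul_of_nonneg_left h16 hδ0.le))
      _ = _ := by ring
  have hnn : 0 ≤ C * ε + δ := by positivity
  rw [← norm_star]
  refine lt_of_le_of_lt (ContinuousLinearMap.opNorm_le_bound _ (Real.sqrt_nonneg (C * ε + δ))
    fun φ => ?_) ((Real.sqrt_lt' one_pos).2 (by simpa using hCε))
  refine abs_le_of_sq_le_sq' ?_ (by positivity) |>.2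
  rw [mul_pow, Real.sq_sqrt hnn]
  exact h9 φ

/-- A stabilizing feedback yields weak observability inequalities for the adjoint system on all
time horizons. -/
theorem observability_of_stabilizing_feedback [CompleteSpace U] (P : Y →L[𝕜] Y) (Q : U →L[𝕜] Y)
    (F : Y →L[𝕜] U) {M ρ : ℝ} (hρ0 : 0 < ρ) (hρ1 : ρ < 1)
    (hG : ∀ k, ‖(P + Q.comp F) ^ k‖ ≤ M * ρ ^ k) :
    ∃ C : ℝ, 0 ≤ C ∧ ∀ (N : ℕ) (φ : Y), ‖(adjoint P ^ N) φ‖ ^ 2 ≤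
      C * ∑ i ∈ Finset.range N, ‖adjoint Q ((adjoint P ^ i) φ)‖ ^ 2 +
        2 * M ^ 2 * (ρ ^ 2) ^ N * ‖φ‖ ^ 2 := by
  set G := adjoint (P + Q.comp F) with hGdef
  have hGeq : G = adjoint P + (adjoint F).comp (adjoint Q) := by
    rw [hGdef, map_add, ContinuousLinearMap.adjoint_comp]
  have hGn : ∀ k, ‖G ^ k‖ ≤ M * ρ ^ k := by
    intro k
    rw [hGdef, ← ContinuousLinearMap.star_eq_adjoint, ← star_pow]
    exact (norm_star _).le.trans (hG k)
  have hM : 0 ≤ M := by simpa using (norm_nonneg _).trans (hG 0)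
  -- Discrete variation of constants for `P^* = G - F^* Q^*`.
  have htel : ∀ (N : ℕ) (φ : Y), (adjoint P ^ N) φ = (G ^ N) φ -
      ∑ j ∈ Finset.range N, (G ^ (N - 1 - j)) (adjoint F (adjoint Q ((adjoint P ^ j) φ))) := by
    intro N φ
    induction N with
    | zero => simp
    | succ N ih =>
      have h1 : (adjoint P ^ (N + 1)) φ = G ((adjoint P ^ N) φ) -
          adjoint F (adjoint Q ((adjoint P ^ N) φ)) := by
        rw [hGeq, pow_succ']
        simp
      rw [h1, Finset.sum_range_succ]
      conv_lhs => rw [ih, map_sub, map_sum]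
      have h2 : G ((G ^ N) φ) = (G ^ (N + 1)) φ := by rw [pow_succ']; rfl
      have h3 : ∀ j ∈ Finset.range N,
          G ((G ^ (N - 1 - j)) (adjoint F (adjoint Q ((adjoint P ^ j) φ)))) =
          (G ^ (N + 1 - 1 - j)) (adjoint F (adjoint Q ((adjoint P ^ j) φ))) := by
        intro j hj
        have := Finset.mem_range.1 hj
        have h4 : N + 1 - 1 - j = N - 1 - j + 1 := by omega
        rw [h4, pow_succ']
        rfl
      rw [h2, Finset.sum_congr rfl h3, ← ih, sub_sub]
      simp
  have hρ2 : ρ ^ 2 < 1 := pow_lt_one₀ hρ0.le hρ1 two_ne_zero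
  refine ⟨2 * (M ^ 2 * ‖adjoint F‖ ^ 2 * (1 - ρ ^ 2)⁻¹), by
    have : 0 < 1 - ρ ^ 2 := by linarith
    positivity, fun N φ => ?_⟩
  set v : ℕ → ℝ := fun j => ‖adjoint Q ((adjoint P ^ j) φ)‖ with hv
  have h5 : ‖(adjoint P ^ N) φ‖ ≤ M * ρ ^ N * ‖φ‖ +
      ∑ j ∈ Finset.range N, (M * ‖adjoint F‖ * ρ ^ (N - 1 - j)) * v j := by
    rw [htel]
    refine (norm_sub_le _ _).trans (add_le_add ((G ^ N).le_of_opNorm_le (hGn N) φ)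
      ((norm_sum_le _ _).trans (Finset.sum_le_sum fun j _ => ?_)))
    refine ((G ^ (N - 1 - j)).le_of_opNorm_le (hGn _) _).trans ?_
    refine (mul_le_mul_of_nonneg_left ((adjoint F).le_opNorm _) (by positivity)).trans
      (le_of_eq ?_)
    simp only [hv]
    ring
  -- Cauchy–Schwarz; the full geometric series bounds the weights uniformly in `N`.
  have h6 : (∑ j ∈ Finset.range N, (M * ‖adjoint F‖ * ρ ^ (N - 1 - j)) * v j) ^ 2 ≤
      M ^ 2 * ‖adjoint F‖ ^ 2 * (1 - ρ ^ 2)⁻¹ * ∑ j ∈ Finset.range N, v j ^ 2 := by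
    refine (Finset.sum_mul_sq_le_sq_mul_sq _ _ _).trans
      (mul_le_mul_of_nonneg_right ?_ (Finset.sum_nonneg fun _ _ => by positivity))
    simp only [mul_pow]
    rw [← Finset.mul_sum]
    refine mul_le_mul_of_nonneg_left ?_ (by positivity)
    rw [Finset.sum_range_reflect (fun j => (ρ ^ j) ^ 2) N, ← tsum_geometric_of_lt_one
      (by positivity) hρ2]
    simp only [← pow_mul, mul_comm _ 2]
    simp only [pow_mul]
    exact (summable_geometric_of_lt_one (by positivity) hρ2).sum_le_tsum _
      fun _ _ => by positivity
  have h7 := pow_le_pow_left₀ (norm_nonneg _) h5 2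
  have h8 := h7.trans (add_sq_le (a := M * ρ ^ N * ‖φ‖))
  calc _ ≤ _ := h8
    _ ≤ 2 * ((M * ρ ^ N * ‖φ‖) ^ 2 +
        M ^ 2 * ‖adjoint F‖ ^ 2 * (1 - ρ ^ 2)⁻¹ * ∑ j ∈ Finset.range N, v j ^ 2) := by gcongr
    _ = _ := by
      rw [← pow_mul ρ 2 N, mul_comm 2 N, pow_mul ρ N 2]
      ring

end DiscreteSystems

/-! ### Integrals of the semigroup and orbits of its adjoint. -/

namespace IsC0Semigroup

variable {𝕜 Y U : Type*} [RCLike 𝕜] [NormedAddCommGroup Y] [InnerProductSpace 𝕜 Y]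
  {S : ℝ → Y →L[𝕜] Y}

theorem map_natCast_mul (hS : IsC0Semigroup S) {T : ℝ} (hT : 0 ≤ T) (k : ℕ) :
    S (k * T) = S T ^ k := by
  induction k with
  | zero => simp [hS.map_zero]; rfl
  | succ k ih =>
    rw [Nat.cast_succ, add_mul, one_mul, hS.map_add _ _ (by positivity) hT, ih, pow_succ]
    rfl

/-- Values of `S` at negative times are arbitrary; passing to `|s|` gives orbits continuous on the
whole line. -/
theorem continuous_abs (hS : IsC0Semigroup S) (x : Y) : Continuous fun s : ℝ => S |s| x :=
  (hS.continuousOn x).comp_continuous _root_.continuous_abs fun s => abs_nonneg s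

variable [CompleteSpace Y]

theorem exists_norm_le (hS : IsC0Semigroup S) (R : ℝ) :
    ∃ C : ℝ, 0 ≤ C ∧ ∀ t, |t| ≤ R → ‖S |t|‖ ≤ C := by
  obtain ⟨C, hC⟩ := banach_steinhaus (g := fun t : Icc (-R) R => S |(t : ℝ)|) (fun x => by
    obtain ⟨C, hC⟩ := isCompact_Icc.exists_bound_of_continuousOn
      (hS.continuous_abs x).continuousOn (s := Icc (-R) R)
    exact ⟨C, fun t => hC t t.2⟩)
  exact ⟨max C 0, le_max_right _ _, fun t ht => (hC ⟨t, abs_le.1 ht⟩).trans (le_max_left _ _)⟩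

variable [NormedSpace ℝ Y]

/-- The bounded operator `x ↦ ∫₀ᵗ S(s) x ds`. -/
noncomputable def integral (hS : IsC0Semigroup S) (t : ℝ) : Y →L[𝕜] Y :=
  LinearMap.mkContinuousOfExistsBound
    { toFun := fun x => ∫ s in (0 : ℝ)..t, S |s| x
      map_add' := fun x y => by
        refine (intervalIntegral.integral_congr fun s _ => _root_.map_add (S |s|) x y).trans ?_
        exact intervalIntegral.integral_add ((hS.continuous_abs x).intervalIntegrable _ _)
          ((hS.continuous_abs y).intervalIntegrable _ _)
      map_smul' := fun c x => by
        refine (intervalIntegral.integral_congr fun s _ => map_smul (S |s|) c x).trans ?_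
        exact (c • ContinuousLinearMap.id 𝕜 Y).intervalIntegral_comp_comm
          ((hS.continuous_abs x).intervalIntegrable 0 t) } (by
    obtain ⟨C, hC0, hC⟩ := hS.exists_norm_le |t|
    refine ⟨C * |t - 0|, fun x => ?_⟩
    refine (intervalIntegral.norm_integral_le_of_norm_le_const (C := C * ‖x‖)
      fun s hs => (S |s|).le_of_opNorm_le (hC s ?_) x).trans (le_of_eq (by ring))
    have := abs_sub_left_of_mem_uIcc (uIoc_subset_uIcc hs)
    simpa using this)

theorem integral_apply (hS : IsC0Semigroup S) (t : ℝ) (x : Y) :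
    hS.integral t x = ∫ s in (0 : ℝ)..t, S |s| x := rfl

theorem continuous_integral_apply (hS : IsC0Semigroup S) (x : Y) :
    Continuous fun t => hS.integral t x :=
  intervalIntegral.continuous_primitive
    (fun a b => (hS.continuous_abs x).intervalIntegrable a b) 0

/-- Local boundedness of `S` makes the integral locally Lipschitz in operator norm. Norm continuity,
unlike strong continuity, passes to adjoints. -/
theorem continuous_integral (hS : IsC0Semigroup S) : Continuous hS.integral := by
  rw [continuous_iff_continuousAt]
  intro t₀
  obtain ⟨C, hC0, hC⟩ := hS.exists_norm_le (|t₀| + 1)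
  have hlip : LipschitzOnWith ⟨C, hC0⟩ hS.integral (Icc (-(|t₀| + 1)) (|t₀| + 1)) := by
    refine LipschitzOnWith.of_dist_le_mul fun a ha b hb => ?_
    rw [dist_eq_norm, Real.dist_eq]
    refine ContinuousLinearMap.opNorm_le_bound _ (by positivity) fun x => ?_
    rw [sub_apply, integral_apply, integral_apply,
      intervalIntegral.integral_interval_sub_left
        ((hS.continuous_abs x).intervalIntegrable _ _)
        ((hS.continuous_abs x).intervalIntegrable _ _)]
    refine (intervalIntegral.norm_integral_le_of_norm_le_const (C := C * ‖x‖)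
      fun s hs => (S |s|).le_of_opNorm_le (hC s ?_) x).trans (le_of_eq ?_)
    · have h1 : uIcc b a ⊆ Icc (-(|t₀| + 1)) (|t₀| + 1) := ordConnected_Icc.uIcc_subset hb ha
      exact abs_le.2 (h1 (uIoc_subset_uIcc hs))
    · change C * ‖x‖ * |a - b| = C * |a - b| * ‖x‖
      ring
  refine hlip.continuousOn.continuousAt (Icc_mem_nhds ?_ ?_)
  · linarith [neg_abs_le t₀]
  · linarith [le_abs_self t₀]

theorem integral_comp (hS : IsC0Semigroup S) {r t : ℝ} (hr : 0 ≤ r) (ht : 0 ≤ t) :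
    (hS.integral r).comp (S t) = hS.integral (r + t) - hS.integral t := by
  ext x
  rw [sub_apply, ContinuousLinearMap.comp_apply, integral_apply, integral_apply,
    integral_apply, intervalIntegral.integral_interval_sub_left
        ((hS.continuous_abs x).intervalIntegrable _ _)
        ((hS.continuous_abs x).intervalIntegrable _ _)]
  have h := intervalIntegral.integral_comp_add_right (a := 0) (b := r) (fun s => S |s| x) t
  rw [zero_add] at h
  rw [← h]
  refine intervalIntegral.integral_congr fun s hs => ?_
  rw [uIcc_of_le hr] at hs
  have h1 : 0 ≤ s + t := add_nonneg hs.1 ht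
  simp only [abs_of_nonneg hs.1, abs_of_nonneg h1, hS.map_add s t hs.1 ht]
  rfl

theorem eq_zero_of_integral_eq_zero (hS : IsC0Semigroup S) {x : Y}
    (h : ∀ r, 0 ≤ r → hS.integral r x = 0) : x = 0 := by
  have h1 : HasDerivAt (fun t => ∫ s in (0 : ℝ)..t, S |s| x) (S |0| x) 0 :=
    intervalIntegral.integral_hasDerivAt_right ((hS.continuous_abs x).intervalIntegrable _ _)
      ((hS.continuous_abs x).stronglyMeasurableAtFilter _ _) (hS.continuous_abs x).continuousAt
  have h2 : HasDerivWithinAt (fun t => ∫ s in (0 : ℝ)..t, S |s| x) 0 (Ici 0) 0 :=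
    (hasDerivWithinAt_const (0 : ℝ) (Ici 0) (0 : Y)).congr (fun r hr => h r hr) (h 0 le_rfl)
  have h3 := (uniqueDiffOn_Ici (0 : ℝ) 0 self_mem_Ici).eq_deriv _ h1.hasDerivWithinAt h2
  simpa [hS.map_zero] using h3

/-- The adjoint of a `C₀`-semigroup has strongly measurable orbits. -/
theorem aestronglyMeasurable_adjoint (hS : IsC0Semigroup S) (φ : Y) :
    AEStronglyMeasurable (fun t : ℝ => adjoint (S |t|) φ) := by
  -- The vectors with measurable adjoint orbit form a closed subspace. It contains the range of each
  -- `adjoint (hS.integral r)` with `0 ≤ r`, whose orbits are norm continuous by `integral_comp`. A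
  -- vector orthogonal to all these ranges is killed by every `hS.integral r`, hence is zero.
  let K : Submodule 𝕜 Y :=
    { carrier := {φ | AEStronglyMeasurable (fun t : ℝ => adjoint (S |t|) φ)}
      add_mem' := fun {x y} hx hy => by
        exact (AEStronglyMeasurable.add hx hy).congr
          (Eventually.of_forall fun t => (_root_.map_add (adjoint (S |t|)) x y).symm)
      zero_mem' := by
        exact (aestronglyMeasurable_const (b := (0 : Y))).congr
          (Eventually.of_forall fun t => (_root_.map_zero (adjoint (S |t|))).symm)
      smul_mem' := fun c x hx => by
        exact (AEStronglyMeasurable.const_smul hx c).congr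
          (Eventually.of_forall fun t => (map_smul (adjoint (S |t|)) c x).symm) }
  have hclosed : IsClosed (K : Set Y) := by
    refine IsSeqClosed.isClosed fun u x hu hx => ?_
    exact aestronglyMeasurable_of_tendsto_ae atTop hu (Eventually.of_forall fun t =>
      ((adjoint (S |t|)).continuous.tendsto x).comp hx)
  have : CompleteSpace K := hclosed.completeSpace_coe
  have hmem : ∀ r, 0 ≤ r → ∀ ψ, adjoint (hS.integral r) ψ ∈ K := by
    intro r hr ψ
    have h1 : ∀ t : ℝ, adjoint (S |t|) (adjoint (hS.integral r) ψ) =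
        adjoint (hS.integral (r + |t|) - hS.integral |t|) ψ := by
      intro t
      rw [← hS.integral_comp hr (abs_nonneg t), ContinuousLinearMap.adjoint_comp]
      rfl
    change AEStronglyMeasurable (fun t : ℝ => adjoint (S |t|) (adjoint (hS.integral r) ψ))
    simp only [h1]
    have := hS.continuous_integral
    refine Continuous.aestronglyMeasurable ?_
    refine ((ContinuousLinearMap.apply 𝕜 Y ψ).continuous.comp
      (adjoint (𝕜 := 𝕜) (E := Y) (F := Y)).continuous).comp ?_
    fun_prop
  have htop : K = ⊤ := by
    rw [← Submodule.orthogonal_eq_bot_iff, Submodule.eq_bot_iff]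
    intro x hx
    refine hS.eq_zero_of_integral_eq_zero fun r hr => ?_
    refine ext_inner_left 𝕜 fun ψ => ?_
    rw [← ContinuousLinearMap.adjoint_inner_left, inner_zero_right]
    exact Submodule.inner_right_of_mem_orthogonal (hmem r hr ψ) hx
  have : φ ∈ K := htop ▸ Submodule.mem_top
  exact this

variable [NormedAddCommGroup U] [InnerProductSpace 𝕜 U] [CompleteSpace U]

theorem intervalIntegrable_adjoint (hS : IsC0Semigroup S) (B : U →L[𝕜] Y) (φ : Y) (a b : ℝ) :
    IntervalIntegrable (fun t : ℝ => adjoint B (adjoint (S |t|) φ)) volume a b := by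
  obtain ⟨C, hC0, hC⟩ := hS.exists_norm_le (max |a| |b|)
  rw [intervalIntegrable_iff]
  refine Measure.integrableOn_of_bounded (M := ‖adjoint B‖ * (C * ‖φ‖)) (by simp)
    ((adjoint B).continuous.comp_aestronglyMeasurable (hS.aestronglyMeasurable_adjoint φ)) ?_
  refine (ae_restrict_iff' measurableSet_uIoc).2 (Eventually.of_forall fun t ht => ?_)
  refine (adjoint B).le_opNorm_of_le ((adjoint (S |t|)).le_of_opNorm_le ?_ φ)
  rw [LinearIsometryEquiv.norm_map]
  refine hC t (abs_le.2 ?_)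
  have h1 := uIoc_subset_uIcc ht
  rw [mem_uIcc] at h1
  have h2 := neg_abs_le a
  have h3 := neg_abs_le b
  have h4 := le_abs_self a
  have h5 := le_abs_self b
  have h6 := le_max_left |a| |b|
  have h7 := le_max_right |a| |b|
  rcases h1 with h1 | h1 <;> constructor <;> linarith [h1.1, h1.2]

variable [NormedSpace ℝ U]

/-- Test against `u` and move the adjoints across the inner product under the integral;
integrability of the adjoint orbit is what permits this. -/
theorem integral_adjoint (hS : IsC0Semigroup S) (B : U →L[𝕜] Y) (φ : Y) (t : ℝ) :
    ∫ s in (0 : ℝ)..t, adjoint B (adjoint (S |s|) φ) = adjoint ((hS.integral t).comp B) φ := by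
  refine ext_inner_left 𝕜 fun u => ?_
  have h1 := (innerSL 𝕜 u).intervalIntegral_comp_comm (hS.intervalIntegrable_adjoint B φ 0 t)
  have h2 := (innerSL 𝕜 φ).intervalIntegral_comp_comm
    ((hS.continuous_abs (B u)).intervalIntegrable (μ := volume) 0 t)
  simp only [innerSL_apply_apply] at h1 h2
  rw [← h1, ContinuousLinearMap.adjoint_inner_right, ContinuousLinearMap.comp_apply,
    integral_apply, ← inner_conj_symm, ← h2]
  simp only [ContinuousLinearMap.adjoint_inner_right]
  have h3 := (RCLike.conjCLE (K := 𝕜)).toContinuousLinearMap.intervalIntegral_comp_comm (μ := volume)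
    (Continuous.intervalIntegrable (μ := volume) (u := fun s => innerSL 𝕜 φ (S |s| (B u)))
      ((innerSL 𝕜 φ).continuous.comp (hS.continuous_abs (B u))) 0 t)
  simp only [innerSL_apply_apply] at h3
  refine Eq.trans ?_ h3
  refine intervalIntegral.integral_congr fun s _ => ?_
  exact (inner_conj_symm _ _).symm

theorem integral_shift_adjoint (hS : IsC0Semigroup S) (B : U →L[𝕜] Y) (φ : Y) {a t : ℝ}
    (ha : 0 ≤ a) (ht : 0 ≤ t) :
    ∫ s in a..(a + t), adjoint B (adjoint (S s) φ) =
      adjoint ((hS.integral t).comp B) (adjoint (S a) φ) := by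
  have h := intervalIntegral.integral_comp_add_left (a := 0) (b := t)
    (fun s => adjoint B (adjoint (S s) φ)) a
  rw [add_zero] at h
  rw [← h, ← integral_adjoint]
  refine intervalIntegral.integral_congr fun s hs => ?_
  rw [uIcc_of_le ht] at hs
  simp only [abs_of_nonneg hs.1, hS.map_add a s ha hs.1, ContinuousLinearMap.adjoint_comp,
    ContinuousLinearMap.comp_apply]

theorem sampledObservation_eq (hS : IsC0Semigroup S) (B : U →L[𝕜] Y) {T : ℝ} (hT : 0 ≤ T)
    (N : ℕ) (φ : Y) :
    sampledObservation S B T N φ = ∑ i ∈ Finset.range N,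
      ‖adjoint ((hS.integral T).comp B) ((adjoint (S T) ^ i) φ)‖ ^ 2 := by
  have hIcc : Finset.Icc 1 N = Finset.Ico 1 (N + 1) := rfl
  rw [sampledObservation, hIcc, Finset.sum_Ico_eq_sum_range, Nat.add_sub_cancel]
  refine Finset.sum_congr rfl fun i _ => ?_
  have h1 : (((1 + i : ℕ) : ℝ) - 1) * T = i * T := by push_cast; ring
  have h2 : ((1 + i : ℕ) : ℝ) * T = i * T + T := by push_cast; ring
  rw [h1, h2, hS.integral_shift_adjoint B φ (by positivity) hT, hS.map_natCast_mul hT,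
    ← ContinuousLinearMap.star_eq_adjoint (S T ^ i), star_pow,
    ContinuousLinearMap.star_eq_adjoint]

end IsC0Semigroup

/-! ### Closed-loop solutions and reduction to discrete time. -/

namespace IsC0Semigroup

variable {𝕜 Y U : Type*} [RCLike 𝕜] [NormedAddCommGroup Y] [InnerProductSpace 𝕜 Y]
  {S : ℝ → Y →L[𝕜] Y} [NormedSpace ℝ Y]

/-- The mild solution with initial value `x` and step forcing `s ↦ g ⌊s / T⌋`. -/
noncomputable def _root_.stepSolution (S : ℝ → Y →L[𝕜] Y) (T : ℝ) (x : Y) (g : ℕ → Y)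
    (t : ℝ) : Y :=
  S t x + ∫ s in (0 : ℝ)..t, S (t - s) (g ⌊s / T⌋₊)

theorem stepSolution_zero (hS : IsC0Semigroup S) (T : ℝ) (x : Y) (g : ℕ → Y) :
    stepSolution S T x g 0 = x := by
  simp [stepSolution, hS.map_zero]

variable [CompleteSpace Y]

/-- On one sampling interval the step forcing `s ↦ g ⌊s / T⌋` is constant. -/
theorem integral_step_last (hS : IsC0Semigroup S) {T : ℝ} (hT : 0 < T) (g : ℕ → Y) (k : ℕ)
    {t : ℝ} (h1 : k * T ≤ t) (h2 : t ≤ (k + 1) * T) :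
    IntervalIntegrable (fun s => S (t - s) (g ⌊s / T⌋₊)) volume (k * T) t ∧
      ∫ s in (k * T)..t, S (t - s) (g ⌊s / T⌋₊) = hS.integral (t - k * T) (g k) := by
  -- The open interval matters: at `t = (k + 1) * T` the floor has already jumped.
  have heq : EqOn (fun s => S |t - s| (g k)) (fun s => S (t - s) (g ⌊s / T⌋₊))
      (uIoo (k * T) t) := by
    intro s hs
    rw [uIoo_of_le h1] at hs
    have h3 : ⌊s / T⌋₊ = k := by
      rw [Nat.floor_eq_iff (div_nonneg ((by positivity : 0 ≤ k * T).trans hs.1.le) hT.le),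
        le_div_iff₀ hT, div_lt_iff₀ hT]
      exact ⟨hs.1.le, hs.2.trans_le h2⟩
    simp only [h3, abs_of_nonneg (sub_nonneg.2 hs.2.le)]
  have hcont : Continuous fun s => S |t - s| (g k) :=
    (hS.continuous_abs (g k)).comp (continuous_const.sub continuous_id)
  refine ⟨(hcont.intervalIntegrable _ _).congr_uIoo heq, ?_⟩
  rw [← intervalIntegral.integral_congr_uIoo heq,
    intervalIntegral.integral_comp_sub_left (fun s => S |s| (g k)), sub_self, integral_apply]

/-- The mild solution at times before `a` is transported to time `t` by `S (t - a)`. -/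
theorem integral_transport (hS : IsC0Semigroup S) {a t : ℝ} (ha : 0 ≤ a) (hat : a ≤ t)
    {f : ℝ → Y} (hf : IntervalIntegrable (fun s => S (a - s) (f s)) volume 0 a) :
    IntervalIntegrable (fun s => S (t - s) (f s)) volume 0 a ∧
      ∫ s in (0 : ℝ)..a, S (t - s) (f s) = S (t - a) (∫ s in (0 : ℝ)..a, S (a - s) (f s)) := by
  have heq : EqOn (fun s => S (t - a) (S (a - s) (f s))) (fun s => S (t - s) (f s))
      (uIoo 0 a) := by
    intro s hs
    rw [uIoo_of_le ha] at hs
    have h1 := hS.map_add (t - a) (a - s) (sub_nonneg.2 hat) (sub_nonneg.2 hs.2.le)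
    rw [sub_add_sub_cancel] at h1
    simp only [h1, ContinuousLinearMap.comp_apply]
  refine ⟨IntervalIntegrable.congr_uIoo ?_ heq, ?_⟩
  · rw [intervalIntegrable_iff] at hf ⊢
    exact (S (t - a)).integrable_comp hf
  · rw [← intervalIntegral.integral_congr_uIoo heq,
      (S (t - a)).intervalIntegral_comp_comm hf]

theorem intervalIntegrable_step (hS : IsC0Semigroup S) {T : ℝ} (hT : 0 < T) (g : ℕ → Y) (k : ℕ) :
    IntervalIntegrable (fun s => S (k * T - s) (g ⌊s / T⌋₊)) volume 0 (k * T) := by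
  induction k with
  | zero => simp
  | succ k ih =>
    have h : (k : ℝ) * T ≤ (k + 1 : ℕ) * T := by
      push_cast
      linarith
    exact (hS.integral_transport (by positivity) h ih).1.trans
      (hS.integral_step_last hT g k h (by push_cast; rfl)).1

theorem stepSolution_eq (hS : IsC0Semigroup S) {T : ℝ} (hT : 0 < T) (x : Y) (g : ℕ → Y) (k : ℕ)
    {t : ℝ} (h1 : k * T ≤ t) (h2 : t ≤ (k + 1) * T) :
    stepSolution S T x g t =
      S (t - k * T) (stepSolution S T x g (k * T)) + hS.integral (t - k * T) (g k) := by
  have hk : 0 ≤ k * T := by positivity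
  obtain ⟨h3, h4⟩ := hS.integral_transport hk h1 (hS.intervalIntegrable_step hT g k)
  obtain ⟨h5, h6⟩ := hS.integral_step_last hT g k h1 h2
  have h7 := hS.map_add (t - k * T) (k * T) (sub_nonneg.2 h1) hk
  rw [sub_add_cancel] at h7
  rw [stepSolution, stepSolution, ← intervalIntegral.integral_add_adjacent_intervals h3 h5, h4,
    h6, h7, _root_.map_add, ContinuousLinearMap.comp_apply, add_assoc]

theorem continuousOn_stepSolution (hS : IsC0Semigroup S) {T : ℝ} (hT : 0 < T) (x : Y)
    (g : ℕ → Y) : ContinuousOn (stepSolution S T x g) (Ici 0) := by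
  have hseg : ∀ k : ℕ, ContinuousOn (stepSolution S T x g) (Icc (k * T) ((k + 1) * T)) := by
    intro k
    have hc : Continuous fun t : ℝ => S |t - k * T| (stepSolution S T x g (k * T)) +
        hS.integral (t - k * T) (g k) :=
      ((hS.continuous_abs _).comp (continuous_id.sub continuous_const)).add
        ((hS.continuous_integral_apply _).comp (continuous_id.sub continuous_const))
    refine hc.continuousOn.congr fun t ht => ?_
    simp only [abs_of_nonneg (sub_nonneg.2 ht.1)]
    exact hS.stepSolution_eq hT x g k ht.1 ht.2
  have hIcc : ∀ k : ℕ, ContinuousOn (stepSolution S T x g) (Icc 0 (k * T)) := by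
    intro k
    induction k with
    | zero => simp
    | succ k ih =>
      have h : Icc (0 : ℝ) ((k + 1 : ℕ) * T) = Icc 0 (k * T) ∪ Icc (k * T) ((k + 1) * T) := by
        rw [Icc_union_Icc_eq_Icc (by positivity) (by linarith)]
        push_cast
        rfl
      rw [h]
      exact ih.union_of_isClosed (hseg k) isClosed_Icc isClosed_Icc
  intro t ht
  obtain ⟨k, hk⟩ := exists_nat_gt (t / T)
  rw [div_lt_iff₀ hT] at hk
  refine (hIcc k t ⟨ht, hk.le⟩).mono_of_mem_nhdsWithin ?_
  rw [← Ici_inter_Iic]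
  exact inter_mem_nhdsWithin _ (Iic_mem_nhds hk)

variable [NormedAddCommGroup U] [InnerProductSpace 𝕜 U] {B : U →L[𝕜] Y} {F : Y →L[𝕜] U}

/-- Closed-loop solutions on one sampling interval. -/
theorem closedLoop_eq (hS : IsC0Semigroup S) {T : ℝ} (hT : 0 < T) {y : ℝ → Y}
    (hy : IsClosedLoopSolution S B F T y) (k : ℕ) {t : ℝ} (h1 : k * T ≤ t)
    (h2 : t ≤ (k + 1) * T) :
    y t = S (t - k * T) (y (k * T)) + hS.integral (t - k * T) (B (F (y (k * T)))) := by
  have h : ∀ t, 0 ≤ t → y t = stepSolution S T (y 0) (fun k : ℕ => B (F (y (k * T)))) t := hy.2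
  have hk : 0 ≤ k * T := by positivity
  rw [h t (hk.trans h1), hS.stepSolution_eq hT _ _ k h1 h2, ← h _ hk]

/-- Closed-loop solutions at sampling times are orbits of `S(T) + (∫₀ᵀ S(s) B ds) F`. -/
theorem closedLoop_natCast_mul (hS : IsC0Semigroup S) {T : ℝ} (hT : 0 < T) {y : ℝ → Y}
    (hy : IsClosedLoopSolution S B F T y) (k : ℕ) :
    y (k * T) = ((S T + ((hS.integral T).comp B).comp F) ^ k) (y 0) := by
  induction k with
  | zero => simp
  | succ k ih =>
    rw [hS.closedLoop_eq hT hy k (by push_cast; linarith) (by push_cast; rfl), ih, pow_succ']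
    have : ((k + 1 : ℕ) : ℝ) * T - k * T = T := by push_cast; ring
    rw [this]
    rfl

/-- The closed-loop system has a solution for each initial value. -/
theorem exists_closedLoopSolution (hS : IsC0Semigroup S) {T : ℝ} (hT : 0 < T)
    (B : U →L[𝕜] Y) (F : Y →L[𝕜] U) (x : Y) :
    ∃ y, IsClosedLoopSolution S B F T y ∧ y 0 = x := by
  set G := S T + ((hS.integral T).comp B).comp F with hG
  -- The forcing is prescribed in advance from the orbit of `G`; `hv` then shows that the samples
  -- reproduce this orbit, closing the loop.
  set g : ℕ → Y := fun k => B (F ((G ^ k) x)) with hg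
  have hv : ∀ k : ℕ, stepSolution S T x g (k * T) = (G ^ k) x := by
    intro k
    induction k with
    | zero => simp [hS.stepSolution_zero]
    | succ k ih =>
      rw [hS.stepSolution_eq hT x g k (by push_cast; linarith) (by push_cast; rfl), ih, pow_succ']
      have : ((k + 1 : ℕ) : ℝ) * T - k * T = T := by push_cast; ring
      rw [this]
      rfl
  refine ⟨stepSolution S T x g, ⟨hS.continuousOn_stepSolution hT x g, fun t _ => ?_⟩,
    hS.stepSolution_zero T x g⟩
  simp only [sampleHold, hv, hS.stepSolution_zero]
  rfl

/-- Sampled-data stabilizability of `(S, B)` is stabilizability of the discrete-time system with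
state operator `S(T)` and input operator `∫₀ᵀ S(s) B ds`. -/
theorem isDCStabilizable_iff (hS : IsC0Semigroup S) (B : U →L[𝕜] Y) {T : ℝ} (hT : 0 < T) :
    IsDCStabilizable S B T ↔ ∃ (F : Y →L[𝕜] U) (M ρ : ℝ), 0 ≤ M ∧ 0 < ρ ∧ ρ < 1 ∧
      ∀ k, ‖(S T + ((hS.integral T).comp B).comp F) ^ k‖ ≤ M * ρ ^ k := by
  constructor
  · rintro ⟨F, M, ω, hM, hω, h⟩
    refine ⟨F, M, Real.exp (-(ω * T)), by linarith, Real.exp_pos _,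
      Real.exp_lt_one_iff.2 (neg_lt_zero.2 (mul_pos hω hT)), fun k => ?_⟩
    refine ContinuousLinearMap.opNorm_le_bound _ (by positivity) fun x => ?_
    obtain ⟨y, hy, rfl⟩ := hS.exists_closedLoopSolution hT B F x
    rw [← hS.closedLoop_natCast_mul hT hy]
    refine (h y hy _ (by positivity)).trans (le_of_eq ?_)
    rw [← Real.exp_nat_mul]
    ring_nf
  · rintro ⟨F, M, ρ, hM, hρ0, hρ1, h⟩
    obtain ⟨C, hC0, hC⟩ := hS.exists_norm_le T
    obtain ⟨D, hD⟩ := isCompact_Icc.exists_bound_of_continuousOn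
      hS.continuous_integral.continuousOn (s := Icc 0 T)
    have hD0 : 0 ≤ D := (norm_nonneg _).trans (hD 0 ⟨le_rfl, hT.le⟩)
    -- Maximal growth within one sampling interval.
    set L : ℝ := C + D * ‖B.comp F‖ with hL
    have hL0 : 0 ≤ L := by positivity
    have hlog : Real.log ρ < 0 := Real.log_neg hρ0 hρ1
    -- The rate satisfies `exp (-ω * T) = ρ`; dividing by `ρ` pays for the incomplete last interval.
    refine ⟨F, max 1 (L * M / ρ), -(Real.log ρ / T), le_max_left _ _,
      neg_pos.2 (div_neg_of_neg_of_pos hlog hT), fun y hy t ht => ?_⟩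
    set k := ⌊t / T⌋₊ with hk
    have h1 : k * T ≤ t := (le_div_iff₀ hT).1 (Nat.floor_le (div_nonneg ht hT.le))
    have h2 : t ≤ (k + 1) * T := ((div_lt_iff₀ hT).1 (Nat.lt_floor_add_one _)).le
    have h3 : ‖y t‖ ≤ L * ‖y (k * T)‖ := by
      rw [hS.closedLoop_eq hT hy k h1 h2, hL, add_mul, mul_assoc D]
      have h4 : 0 ≤ t - k * T := by linarith
      have h5 : t - k * T ≤ T := by linarith
      refine (norm_add_le _ _).trans (add_le_add ?_ ?_)
      · refine (S (t - k * T)).le_of_opNorm_le ?_ _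
        have := hC (t - k * T) (by rwa [abs_of_nonneg h4])
        rwa [abs_of_nonneg h4] at this
      · exact ((hS.integral (t - k * T)).le_of_opNorm_le (hD _ ⟨h4, h5⟩) _).trans
          (mul_le_mul_of_nonneg_left ((B.comp F).le_opNorm _) hD0)
    have h6 : ‖y (k * T)‖ ≤ M * ρ ^ k * ‖y 0‖ := by
      rw [hS.closedLoop_natCast_mul hT hy]
      exact ContinuousLinearMap.le_of_opNorm_le _ (h k) _
    have h7 : ρ ^ k ≤ Real.exp (-(-(Real.log ρ / T)) * t) / ρ := by
      rw [le_div_iff₀ hρ0, ← pow_succ, neg_neg, ← Real.exp_log (pow_pos hρ0 (k + 1)),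
        Real.exp_le_exp, Real.log_pow, div_mul_eq_mul_div, le_div_iff₀ hT]
      push_cast
      nlinarith
    calc ‖y t‖ ≤ L * (M * ρ ^ k * ‖y 0‖) := h3.trans (mul_le_mul_of_nonneg_left h6 hL0)
      _ ≤ L * (M * (Real.exp (-(-(Real.log ρ / T)) * t) / ρ) * ‖y 0‖) := by gcongr
      _ = L * M / ρ * Real.exp (-(-(Real.log ρ / T)) * t) * ‖y 0‖ := by ring
      _ ≤ _ := by gcongr; exact le_max_right _ _

end IsC0Semigroup

/-! ### The equivalence. -/

theorem theorem1p6 {𝕜 Y U : Type*} [RCLike 𝕜]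
    [NormedAddCommGroup Y] [InnerProductSpace 𝕜 Y] [CompleteSpace Y] [NormedSpace ℝ Y]
    [NormedAddCommGroup U] [InnerProductSpace 𝕜 U] [CompleteSpace U] [NormedSpace ℝ U]
    (A : Y →ₗ.[𝕜] Y) (S : ℝ → Y →L[𝕜] Y) (hS : IsC0Semigroup S) (hA : IsGenerator A S)
    (B : U →L[𝕜] Y) (T : ℝ) (hT : 0 < T) :
    List.TFAE [
      IsDCStabilizable S B T,
      ∃ ω C₁ C₂ : ℝ, 0 < ω ∧ 0 ≤ C₁ ∧ 0 < C₂ ∧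
        ∀ N : ℕ, 1 ≤ N → ∀ φ : Y,
          ‖ContinuousLinearMap.adjoint (S ((N : ℝ) * T)) φ‖ ^ 2 ≤
            C₁ * sampledObservation S B T N φ +
              C₂ * Real.exp (-ω * ((N : ℝ) * T)) * ‖φ‖ ^ 2,
      ∃ (N : ℕ) (δ C : ℝ), 1 ≤ N ∧ 0 < δ ∧ δ < 1 ∧ 0 ≤ C ∧
        ∀ φ : Y,
          ‖ContinuousLinearMap.adjoint (S ((N : ℝ) * T)) φ‖ ^ 2 ≤
            C * sampledObservation S B T N φ + δ * ‖φ‖ ^ 2] := by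
  have hadj : ∀ N : ℕ, adjoint (S (N * T)) = adjoint (S T) ^ N := by
    intro N
    rw [hS.map_natCast_mul hT.le, ← ContinuousLinearMap.star_eq_adjoint, star_pow,
      ContinuousLinearMap.star_eq_adjoint]
  simp only [hadj, hS.sampledObservation_eq B hT.le]
  tfae_have 1 → 2 := by
    rw [hS.isDCStabilizable_iff B hT]
    rintro ⟨F, M, ρ, hM, hρ0, hρ1, h⟩
    obtain ⟨C, hC0, hC⟩ := observability_of_stabilizing_feedback _ _ F hρ0 hρ1 h
    have hlog : Real.log ρ < 0 := Real.log_neg hρ0 hρ1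
    -- The rate makes `exp (-ω * (N * T)) = (ρ ^ 2) ^ N`; the `+ 1` keeps `C₂` positive even if `M =
    -- 0`.
    refine ⟨-(2 * Real.log ρ / T), C, 2 * M ^ 2 + 1,
      neg_pos.2 (div_neg_of_neg_of_pos (by linarith) hT), hC0, by positivity, fun N _ φ => ?_⟩
    have hexp : Real.exp (-(-(2 * Real.log ρ / T)) * (N * T)) = (ρ ^ 2) ^ N := by
      have h1 : -(-(2 * Real.log ρ / T)) * (N * T) = N * (2 * Real.log ρ) := by
        field_simp
      rw [h1, Real.exp_nat_mul, two_mul, Real.exp_add, Real.exp_log hρ0, ← sq]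
    rw [hexp]
    refine (hC N φ).trans ?_
    gcongr
    linarith
  tfae_have 2 → 3 := by
    rintro ⟨ω, C₁, C₂, hω, hC₁, hC₂, h⟩
    have hlim : Tendsto (fun N : ℕ => C₂ * Real.exp (-ω * ((N : ℝ) * T))) atTop (𝓝 0) := by
      have h1 := tendsto_pow_atTop_nhds_zero_of_lt_one (Real.exp_pos (-(ω * T))).le
        (Real.exp_lt_one_iff.2 (neg_lt_zero.2 (mul_pos hω hT)))
      have h2 := h1.const_mul C₂
      rw [mul_zero] at h2
      refine h2.congr fun N => ?_
      rw [← Real.exp_nat_mul]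
      ring_nf
    obtain ⟨N, hN, hN1⟩ := ((hlim.eventually_lt_const one_pos).and
      (eventually_ge_atTop 1)).exists
    exact ⟨N, _, C₁, hN1, mul_pos hC₂ (Real.exp_pos _), hN, hC₁, fun φ => h N hN1 φ⟩
  tfae_have 3 → 1 := by
    rintro ⟨N, δ, C, hN, hδ0, hδ1, hC, h⟩
    rw [hS.isDCStabilizable_iff B hT]
    exact exists_stabilizing_feedback_of_observability _ _ hN hδ0 hδ1 hC h
  tfae_finish
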